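/- Let $\mathbb F$ be a (commutative) field with at least three elements, let $m,n$ be integers with $m\ge n\ge 2$, and let $M_{m,n}$ be the space of all $m\times n$ matrices over $\mathbb F$. Let $\phi: M_{m,n}\to M_{m,n}$ be a bijective map such that for all $A,B\in M_{m,n}$ $$\operatorname{rank}(A-B)=n \iff \operatorname{rank}(\phi(A)-\phi(B))=n .$$ Then there exist an invertible $m\times m$ matrix $T$, an invertible $n\times n$ matrix $S$, an $m\times n$ matrix $R$ (all over $\mathbb F$), and a field automorphism $\sigma:\mathbb F\to\mathbb F$ such that either $$\phi(A)=T A_\sigma S+R\quad\text{for every } A\in M_{m,n},$$ or $m=n$ and $$\phi(A)=T (A_\sigma)^t S+R\quad\text{for every } A\in M_{n,n}.$$ Here, for $A=[a_{ij}]$, $A_\sigma=[\sigma(a_{ij})]$ is the matrix obtained by applying $\sigma$ entrywise, and $A^t$ denotes the transpose of $A$. -/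

import Mathlib

/-!
The relation "`A - B` has rank `n`" determines the lines `{A + t • x yᵗ}`: for distinct `A`, `B`,
call `R` between them if every `X` with `R - X` of rank `n` has `A - X` or `B - X` of rank `n`.
If `B - A` has rank one, the points between `A` and `B` are those of the line through them; if not,
they are only `A` and `B` (`fullRankBetween_of_line`, `line_of_fullRankBetween`). A line has a third
point when the field has three elements, so `φ` and its inverse preserve adjacency and lines of
rank-one direction (`preservesDyadLines_of_rank`).

It remains to prove Hua's theorem for such maps. Assume `φ 0 = 0`. For fixed `x` the matrices
`x yᵗ` form a vector space on whose lines `φ` acts, so `φ` is additive there by the fundamental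
theorem of affine geometry (`map_add_of_lines`); they are pairwise adjacent, so their images
share a left or a right factor, and the same alternative holds for all `x`. After transposing if
necessary, `φ (x yᵗ) = f x (g y)ᵗ` with `f` and `g` semilinear for one automorphism `σ`
(`isSemilinearTensor_or`).

All of this applies to the translate `X ↦ φ (B + X) - φ B` at any `B`. The translates at two
adjacent points `B` and `B + u wᵗ` agree on the matrices `u yᵗ` and `x wᵗ`, and since both are
tensor products they agree on all dyads `x yᵗ` (`map_vecMulVec_add_vecMulVec`). Therefore all translates agree
on dyads and `φ` is additive (`map_add`). The matrices of `f` and `g` are `T` and `Sᵗ`; in the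
transposed case, injectivity of `f` gives `m ≤ n`.
-/

open Matrix

section

variable {F : Type*} [Field F]

/-! ### Line-preserving maps of vector spaces -/

section Affine

variable {V W : Type*} [AddCommGroup V] [Module F V] [AddCommGroup W] [Module F W]

theorem ne_smul_symm {v w : V} (hv : v ≠ 0) (h : ∀ c : F, w ≠ c • v) (c : F) : v ≠ c • w := by
  intro e
  have hc : c ≠ 0 := by
    rintro rfl
    exact hv (by simpa using e)
  exact h c⁻¹ (by rw [e, smul_smul, inv_mul_cancel₀ hc, one_smul])

theorem map_add_mem_span_of_lines {f : V → W} (h0 : f 0 = 0)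
    (line : ∀ (a v : V) (t : F), ∃ s : F, f (a + t • v) - f a = s • (f (a + v) - f a))
    (hF : ∃ c : F, c ≠ 0 ∧ c ≠ 1) (x y : V) :
    ∃ α β : F, f (x + y) = α • f x + β • f y := by
  obtain ⟨c, hc0, hc1⟩ := hF
  have hc1' : c - 1 ≠ 0 := sub_ne_zero.mpr hc1
  have hmul : ∀ (v : V) (t : F), ∃ s : F, f (t • v) = s • f v := by
    intro v t
    obtain ⟨s, hs⟩ := line 0 v t
    exact ⟨s, by simpa [h0] using hs⟩
  obtain ⟨s, hs⟩ := hmul x c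
  obtain ⟨t, ht⟩ := hmul y (c / (c - 1))
  obtain ⟨k, hk⟩ := line (c • x) ((c / (c - 1)) • y - c • x) ((c - 1) / c)
  -- `x + y` lies on the line joining `c • x` to `(c / (c - 1)) • y`
  have e : c • x + ((c - 1) / c) • ((c / (c - 1)) • y - c • x) = x + y := by
    rw [smul_sub, smul_smul, smul_smul]
    have h1 : (c - 1) / c * (c / (c - 1)) = 1 := by field_simp
    have h2 : (c - 1) / c * c = c - 1 := by field_simp
    rw [h1, h2]
    module
  rw [e, add_sub_cancel, hs, ht, sub_eq_iff_eq_add] at hk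
  exact ⟨s - k * s, k * t, by rw [hk]; module⟩

theorem coeff_eq_one_of_lines {f : V → W} (h0 : f 0 = 0) (inj : Function.Injective f)
    (surj : ∀ (a v : V) (s : F), ∃ t : F, f (a + t • v) - f a = s • (f (a + v) - f a))
    {x y : V} (hxy : ∀ c : F, x ≠ c • y) {α β : F} (h : f (x + y) = α • f x + β • f y) :
    α = 1 := by
  by_contra hα
  have hα' : α - 1 ≠ 0 := sub_ne_zero.mpr hα
  obtain ⟨t, ht⟩ := surj x y (-(α - 1)⁻¹)
  obtain ⟨r, hr⟩ := surj 0 y (-(α - 1)⁻¹ * β)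
  have h1 : f (x + t • y) = (-(α - 1)⁻¹ * β) • f y := by
    rw [sub_eq_iff_eq_add.mp ht, h]
    have : -(α - 1)⁻¹ • (α • f x + β • f y - f x) + f x
        = (-((α - 1)⁻¹ * (α - 1)) + 1) • f x + (-(α - 1)⁻¹ * β) • f y := by module
    rw [this, inv_mul_cancel₀ hα']
    simp
  have h2 : f (r • y) = (-(α - 1)⁻¹ * β) • f y := by simpa [h0] using hr
  have h3 := inj (h1.trans h2.symm)
  exact hxy (r - t) (by rw [sub_smul, ← h3]; abel)

/-- The additive half of the fundamental theorem of affine geometry: an injective map fixing the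
origin that sends lines onto lines is additive, in dimension at least two and over a field with
more than two elements. For independent `x`, `y`, the image of `x + y` lies in the span of `f x`
and `f y`, and its coefficients are `1` because parallel lines have disjoint images. -/
theorem map_add_of_lines {f : V → W} (h0 : f 0 = 0) (inj : Function.Injective f)
    (line : ∀ (a v : V) (t : F), ∃ s : F, f (a + t • v) - f a = s • (f (a + v) - f a))
    (surj : ∀ (a v : V) (s : F), ∃ t : F, f (a + t • v) - f a = s • (f (a + v) - f a))
    (hF : ∃ c : F, c ≠ 0 ∧ c ≠ 1) (hV : ∀ v : V, ∃ w : V, ∀ c : F, w ≠ c • v) (x y : V) :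
    f (x + y) = f x + f y := by
  have indep : ∀ x z : V, (∀ c : F, z ≠ c • x) → f (x + z) = f x + f z := by
    intro x z hz
    by_cases hx : x = 0
    · simp [hx, h0]
    obtain ⟨α, β, h⟩ := map_add_mem_span_of_lines h0 line hF x z
    have hα := coeff_eq_one_of_lines h0 inj surj (ne_smul_symm hx hz) h
    have hβ := coeff_eq_one_of_lines h0 inj surj hz
      (α := β) (β := α) (by rw [add_comm z x, h, add_comm])
    rw [h, hα, hβ, one_smul, one_smul]
  by_cases hy : ∀ c : F, y ≠ c • x
  · exact indep x y hy
  push Not at hy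
  obtain ⟨c, rfl⟩ := hy
  obtain ⟨z, hz⟩ := hV x
  have h1 : f (x + (c • x + z)) = f x + (f (c • x) + f z) := by
    rw [indep x (c • x + z), indep (c • x) z]
    · intro d e
      exact hz (d * c) (by rw [e, smul_smul])
    · intro d e
      exact hz (d - c) (by rw [sub_smul, ← e]; abel)
  have h2 : f (x + (c • x + z)) = f (x + c • x) + f z := by
    rw [← add_assoc, indep]
    intro d e
    exact hz (d * (1 + c)) (by rw [e]; module)
  rw [h1, ← add_assoc] at h2
  exact (add_right_cancel h2).symm

end Affine

theorem exists_ne_smul {n : Type*} [Nontrivial n] (v : n → F) :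
    ∃ w : n → F, ∀ c : F, w ≠ c • v := by
  classical
  obtain ⟨i, j, hij⟩ := exists_pair_ne n
  by_cases hi : v i = 0
  · refine ⟨Pi.single i 1, fun c e => ?_⟩
    simpa [hi] using congrFun e i
  · refine ⟨Pi.single j 1, fun c e => ?_⟩
    have h1 : c = 0 := by simpa [hij, hi] using congrFun e i
    simpa [h1] using congrFun e j

/-! ### Matrices of rank at most one -/

/-- The matrix is a product `x yᵗ`, that is, it has rank at most one. -/
def IsDyad {m n : Type*} (M : Matrix m n F) : Prop := ∃ x y, M = vecMulVec x y

section Dyad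

variable {m n : Type*}

theorem IsDyad.transpose {M : Matrix m n F} (h : IsDyad M) : IsDyad Mᵀ := by
  obtain ⟨x, y, rfl⟩ := h
  exact ⟨y, x, by rw [transpose_vecMulVec]⟩

theorem isDyad_transpose {M : Matrix m n F} : IsDyad Mᵀ ↔ IsDyad M :=
  ⟨fun h => by simpa using h.transpose, IsDyad.transpose⟩

theorem vecMulVec_right_cancel {a a' : m → F} {b : n → F} (hb : b ≠ 0)
    (h : vecMulVec a b = vecMulVec a' b) : a = a' := by
  obtain ⟨j, hj⟩ := Function.ne_iff.mp hb
  funext i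
  exact mul_right_cancel₀ hj (congrFun (congrFun h i) j)

theorem vecMulVec_left_cancel {a : m → F} {b b' : n → F} (ha : a ≠ 0)
    (h : vecMulVec a b = vecMulVec a b') : b = b' := by
  obtain ⟨i, hi⟩ := Function.ne_iff.mp ha
  funext j
  exact mul_left_cancel₀ hi (congrFun (congrFun h i) j)

theorem vecMulVec_zero_right (a : m → F) : vecMulVec a (0 : n → F) = 0 :=
  ext fun _ _ => mul_zero _

theorem vecMulVec_ne_zero' {a : m → F} {b : n → F} (ha : a ≠ 0) (hb : b ≠ 0) :
    vecMulVec a b ≠ 0 := fun h =>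
  ha (vecMulVec_right_cancel hb (by rw [h, zero_vecMulVec]))

theorem right_eq_smul_of_vecMulVec_eq {a c : m → F} {b d : n → F} (ha : a ≠ 0)
    (h : vecMulVec a b = vecMulVec c d) : ∃ s : F, b = s • d := by
  obtain ⟨i, hi⟩ := Function.ne_iff.mp ha
  refine ⟨c i / a i, funext fun j => ?_⟩
  have := congrFun (congrFun h i) j
  simp only [vecMulVec_apply, Pi.zero_apply] at this hi
  simp only [Pi.smul_apply, smul_eq_mul]
  field_simp
  linear_combination this

theorem left_eq_smul_of_vecMulVec_eq {a c : m → F} {b d : n → F} (hb : b ≠ 0)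
    (h : vecMulVec a b = vecMulVec c d) : ∃ s : F, a = s • c := by
  apply right_eq_smul_of_vecMulVec_eq (b := a) (d := c) hb (c := d)
  simpa [transpose_vecMulVec] using congrArg Matrix.transpose h

/-- Two dyads whose difference is a dyad share a factor, up to scalars: each 2 × 2 minor of the
difference is the product of a minor of the left factors and one of the right factors. -/
theorem eq_smul_or_eq_smul_of_isDyad_sub {a c : m → F} {b d : n → F} (ha : a ≠ 0) (hb : b ≠ 0)
    (h : IsDyad (vecMulVec a b - vecMulVec c d)) :
    (∃ s : F, c = s • a) ∨ ∃ s : F, d = s • b := by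
  obtain ⟨e, f, h⟩ := h
  have hent : ∀ i j, a i * b j - c i * d j = e i * f j := fun i j => congrFun (congrFun h i) j
  obtain ⟨i₀, hi₀⟩ := Function.ne_iff.mp ha
  obtain ⟨k₀, hk₀⟩ := Function.ne_iff.mp hb
  simp only [Pi.zero_apply] at hi₀ hk₀
  have minor : ∀ i j k l, (a i * c j - a j * c i) * (b k * d l - b l * d k) = 0 := by
    intro i j k l
    linear_combination (-(a j * b l) + c j * d l) * hent i k - e i * f k * hent j l
      + (a j * b k - c j * d k) * hent i l + e i * f l * hent j k
  by_cases hc : ∀ j, a i₀ * c j - a j * c i₀ = 0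
  · refine Or.inl ⟨c i₀ / a i₀, funext fun j => ?_⟩
    simp only [Pi.smul_apply, smul_eq_mul]
    field_simp
    linear_combination hc j
  · push Not at hc
    obtain ⟨j, hj⟩ := hc
    refine Or.inr ⟨d k₀ / b k₀, funext fun l => ?_⟩
    have := (mul_eq_zero.mp (minor i₀ j k₀ l)).resolve_left hj
    simp only [Pi.smul_apply, smul_eq_mul]
    field_simp
    linear_combination this

end Dyad

/-! ### Full-rank differences determine the lines of rank-one direction -/

section FullRank

variable {m n : Type*} [Fintype m] [Fintype n]

omit [Fintype m] in
theorem rank_eq_card_iff [Finite m] (A : Matrix m n F) :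
    A.rank = Fintype.card n ↔ ∀ v, A *ᵥ v = 0 → v = 0 := by
  have h := LinearMap.finrank_range_add_finrank_ker A.mulVecLin
  rw [Module.finrank_fintype_fun_eq_card] at h
  rw [← Matrix.ker_mulVecLin_eq_bot_iff, ← Submodule.finrank_eq_zero (R := F), Matrix.rank]
  lia

theorem exists_linearEquiv_apply_eq {ι V : Type*} [Finite ι] [AddCommGroup V] [Module F V]
    {v w : ι → V} (hv : LinearIndependent F v) (hw : LinearIndependent F w) :
    ∃ g : V ≃ₗ[F] V, ∀ i, g (v i) = w i := by
  have : FiniteDimensional F (Submodule.span F (Set.range v)) :=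
    FiniteDimensional.span_of_finite F (Set.finite_range _)
  obtain ⟨g, hg⟩ := Submodule.exists_linearEquiv_restrict_eq
    (hv.linearCombinationEquiv.symm ≪≫ₗ hw.linearCombinationEquiv)
  refine ⟨g, fun i => ?_⟩
  have h1 : (hv.linearCombinationEquiv (Finsupp.single i 1) : V) = v i := by simp
  rw [← h1, ← hg]
  simp

theorem exists_full_rank_mulVec_eq [Nonempty n] (hmn : Fintype.card n ≤ Fintype.card m)
    {ι : Type*} [Finite ι] {v : ι → n → F} {w : ι → m → F}
    (hv : LinearIndependent F v) (hw : LinearIndependent F w) :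
    ∃ Y : Matrix m n F, Y.rank = Fintype.card n ∧ ∀ i, Y *ᵥ v i = w i := by
  classical
  obtain ⟨e⟩ := Function.Embedding.nonempty_of_card_le hmn
  let j : (n → F) →ₗ[F] (m → F) := LinearMap.funLeft F F (Function.invFun e)
  have hj : Function.Injective j :=
    LinearMap.funLeft_injective_of_surjective _ _ _ (Function.invFun_surjective e.injective)
  obtain ⟨g, hg⟩ := exists_linearEquiv_apply_eq
    (hv.map' j (LinearMap.ker_eq_bot.mpr hj)) hw
  refine ⟨LinearMap.toMatrix' (g.toLinearMap ∘ₗ j), ?_, fun i => ?_⟩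
  · rw [rank_eq_card_iff]
    intro x hx
    rw [LinearMap.toMatrix'_mulVec] at hx
    exact hj (by simpa using hx)
  · rw [LinearMap.toMatrix'_mulVec]
    exact hg i

/-- No matrix has a full-rank difference with `R` without having one with `A` or with `B`. -/
def FullRankBetween (A B R : Matrix m n F) : Prop :=
  ∀ X, (R - X).rank = Fintype.card n →
    (A - X).rank = Fintype.card n ∨ (B - X).rank = Fintype.card n

omit [Fintype m] in
/-- If `A - X` and `B - X` kill nonzero vectors `p` and `q`, and `B - A` has rank at most one,
then `R - X` kills a nonzero combination of `p` and `q`. -/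
theorem fullRankBetween_of_line [Finite m] {A B R : Matrix m n F} (hd : IsDyad (B - A)) {t : F}
    (hR : R - A = t • (B - A)) : FullRankBetween A B R := by
  obtain ⟨x, y, hxy⟩ := hd
  intro X hX
  by_contra! hcon
  rw [ne_eq, ne_eq, rank_eq_card_iff, rank_eq_card_iff] at hcon
  push Not at hcon
  obtain ⟨⟨p, hp, hp0⟩, q, hq, hq0⟩ := hcon
  rw [rank_eq_card_iff] at hX
  have hRX : ∀ z, (R - X) *ᵥ z = (A - X) *ᵥ z + (t * (y ⬝ᵥ z)) • x := by
    intro z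
    have : R - X = (A - X) + t • (B - A) := by rw [← hR]; abel
    rw [this, hxy, add_mulVec, smul_mulVec, vecMulVec_mulVec, op_smul_eq_smul, smul_smul]
  have hBX : ∀ z, (B - X) *ᵥ z = (A - X) *ᵥ z + (y ⬝ᵥ z) • x := by
    intro z
    have : B - X = (A - X) + (B - A) := by abel
    rw [this, hxy, add_mulVec, vecMulVec_mulVec, op_smul_eq_smul]
  by_cases hyp : y ⬝ᵥ p = 0
  · exact hp0 (hX p (by rw [hRX, hp, hyp]; simp))
  by_cases hyq : y ⬝ᵥ q = 0
  · rw [hBX, hyq] at hq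
    exact hq0 (hX q (by rw [hRX, hyq]; simpa using hq))
  -- `z` has `y ⬝ᵥ z = 1` and `(A - X) *ᵥ z = -t • x`
  have hAq : (A - X) *ᵥ q = -((y ⬝ᵥ q) • x) := eq_neg_of_add_eq_zero_left (by rw [← hBX, hq])
  have hz := hX (((1 - t) / (y ⬝ᵥ p)) • p + (t / (y ⬝ᵥ q)) • q) (by
    rw [hRX, mulVec_add, mulVec_smul, mulVec_smul, hp, hAq, dotProduct_add, dotProduct_smul,
      dotProduct_smul, smul_eq_mul, smul_eq_mul, div_mul_cancel₀ _ hyp, div_mul_cancel₀ _ hyq,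
      smul_neg, smul_smul, div_mul_cancel₀ _ hyq]
    module)
  have := congrArg (y ⬝ᵥ ·) hz
  simp only [dotProduct_add, dotProduct_smul, smul_eq_mul, div_mul_cancel₀ _ hyp,
    div_mul_cancel₀ _ hyq, dotProduct_zero] at this
  simp at this

theorem pair_linearIndependent {V : Type*} [AddCommGroup V] [Module F V] {v w : V} (hv : v ≠ 0)
    (h : ∀ c : F, w ≠ c • v) : LinearIndependent F ![v, w] :=
  (LinearIndependent.pair_iff' hv).mpr fun c e => h c e.symm

omit [Fintype m] in
/-- If every value of `D` at a vector independent of `p` lies on the line of `a`, then so does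
every value. -/
theorem eq_vecMulVec_of_mulVec [Nontrivial n] {D : Matrix m n F} {a : m → F} {p : n → F}
    (h : ∀ q, (∀ c : F, q ≠ c • p) → ∃ s : F, D *ᵥ q = s • a) :
    ∃ δ : n → F, D = vecMulVec a δ := by
  classical
  have all : ∀ q, ∃ s : F, D *ᵥ q = s • a := by
    intro q
    by_cases hq : ∀ c : F, q ≠ c • p
    · exact h q hq
    push Not at hq
    obtain ⟨c, rfl⟩ := hq
    obtain ⟨r, hr⟩ := exists_ne_smul p
    obtain ⟨s₁, h₁⟩ := h (c • p + r) fun d e => hr (d - c) (by rw [sub_smul, ← e]; abel)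
    obtain ⟨s₂, h₂⟩ := h r hr
    exact ⟨s₁ - s₂, by rw [sub_smul, ← h₁, ← h₂, mulVec_add]; abel⟩
  choose s hs using fun j => all (Pi.single j 1)
  refine ⟨s, ?_⟩
  ext i j
  have := congrFun (hs j) i
  rw [mulVec_single_one] at this
  simpa [vecMulVec_apply, mul_comm] using this

/-- The converse of `fullRankBetween_of_line`. Put `R' = R - A` and `D = R - B`. For nonzero `p`
and `q`, a full-rank `Y` with `Y p = R' p` and `Y q = D q` would make `X = R - Y` violate
`FullRankBetween A B R`. So `R' p` and `D q` are dependent whenever `p` and `q` are independent,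
which forces `R'` and `D` to have rank one with a common column space; and `R' p = 0` whenever
`R' p = D p`, which makes them proportional. -/
theorem line_of_fullRankBetween [Nontrivial n] (hmn : Fintype.card n ≤ Fintype.card m)
    {A B R : Matrix m n F} (hAB : A ≠ B) (hRA : R ≠ A) (hRB : R ≠ B)
    (h : FullRankBetween A B R) : IsDyad (B - A) ∧ ∃ t : F, R - A = t • (B - A) := by
  classical
  have key : ∀ Y : Matrix m n F, Y.rank = Fintype.card n → ∀ p q : n → F, p ≠ 0 → q ≠ 0 →
      Y *ᵥ p = (R - A) *ᵥ p → Y *ᵥ q = (R - B) *ᵥ q → False := by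
    intro Y hY p q hp hq h1 h2
    have := h (R - Y) (by rwa [sub_sub_cancel])
    rw [rank_eq_card_iff, rank_eq_card_iff] at this
    rcases this with h' | h'
    · refine hp (h' p ?_)
      have e : A - (R - Y) = Y - (R - A) := by abel
      rw [e, sub_mulVec, h1, sub_self]
    · refine hq (h' q ?_)
      have e : B - (R - Y) = Y - (R - B) := by abel
      rw [e, sub_mulVec, h2, sub_self]
  have dep : ∀ p q : n → F, p ≠ 0 → (∀ c : F, q ≠ c • p) → (R - A) *ᵥ p ≠ 0 →
      ∃ s : F, (R - B) *ᵥ q = s • ((R - A) *ᵥ p) := by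
    intro p q hp hq hRp
    by_contra! hcon
    have hv : LinearIndependent F ![p, q] := pair_linearIndependent hp hq
    have hw : LinearIndependent F ![(R - A) *ᵥ p, (R - B) *ᵥ q] := pair_linearIndependent hRp hcon
    obtain ⟨Y, hY, hYv⟩ := exists_full_rank_mulVec_eq hmn hv hw
    have hYp : Y *ᵥ p = (R - A) *ᵥ p := by simpa only [cons_val_zero] using hYv 0
    have hYq : Y *ᵥ q = (R - B) *ᵥ q := by simpa only [cons_val_one, cons_val_zero] using hYv 1
    have hq0 : q ≠ 0 := by simpa using hq 0
    exact key Y hY p q hp hq0 hYp hYq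
  have same : ∀ p : n → F, (B - A) *ᵥ p = 0 → (R - A) *ᵥ p = 0 := by
    intro p hp
    by_contra hRp
    have hp0 : p ≠ 0 := by
      rintro rfl
      simp at hRp
    obtain ⟨Y, hY, hYv⟩ := exists_full_rank_mulVec_eq (ι := Unit) (v := fun _ => p)
      (w := fun _ => (R - A) *ᵥ p) hmn (LinearIndependent.of_subsingleton () hp0)
      (LinearIndependent.of_subsingleton () hRp)
    refine key Y hY p p hp0 hp0 (hYv ()) ((hYv ()).trans ?_)
    have e : R - B = (R - A) - (B - A) := by abel
    rw [e, sub_mulVec (R - A), hp, sub_zero]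
  have exists_ne : ∀ {M : Matrix m n F}, M ≠ 0 → ∃ p, M *ᵥ p ≠ 0 := by
    intro M hM
    by_contra! hcon
    exact hM (Matrix.ext_of_mulVec_single fun i => by rw [hcon, zero_mulVec])
  obtain ⟨p, hp⟩ := exists_ne (sub_ne_zero.mpr hRA)
  have hp0 : p ≠ 0 := by
    rintro rfl
    simp at hp
  obtain ⟨δ, hδ⟩ := eq_vecMulVec_of_mulVec fun q hq => dep p q hp0 hq hp
  set a := (R - A) *ᵥ p with ha
  have hδ0 : δ ≠ 0 := by
    rintro rfl
    exact hRB (sub_eq_zero.mp (by rw [hδ, vecMulVec_zero_right]))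
  obtain ⟨q, hq⟩ := exists_ne (sub_ne_zero.mpr hRB)
  have hq0 : q ≠ 0 := by
    rintro rfl
    simp at hq
  obtain ⟨ρ, hρ⟩ : ∃ ρ, R - A = vecMulVec a ρ := by
    refine eq_vecMulVec_of_mulVec (p := q) fun r hr => ?_
    by_cases hRr : (R - A) *ᵥ r = 0
    · exact ⟨0, by rw [hRr, zero_smul]⟩
    have hr0 : r ≠ 0 := by
      rintro rfl
      simp at hRr
    obtain ⟨s, hs⟩ := dep r q hr0 (ne_smul_symm hq0 hr) hRr
    have hs0 : s ≠ 0 := by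
      rintro rfl
      exact hq (by simpa using hs)
    refine ⟨s⁻¹ * (δ ⬝ᵥ q), ?_⟩
    rw [hδ, vecMulVec_mulVec, op_smul_eq_smul] at hs
    rw [mul_smul, hs, smul_smul, inv_mul_cancel₀ hs0, one_smul]
  have hBA : B - A = vecMulVec a (ρ - δ) := by
    have e : B - A = (R - A) - (R - B) := by abel
    rw [e, hδ, hρ, vecMulVec_sub]
  refine ⟨⟨_, _, hBA⟩, ?_⟩
  have hγ : ρ - δ ≠ 0 := by
    intro e
    exact hAB (sub_eq_zero.mp (by rw [hBA, e, vecMulVec_zero_right])).symm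
  -- the kernel of `ρ - δ` lies in that of `ρ`
  have ker : ∀ r : n → F, (ρ - δ) ⬝ᵥ r = 0 → ρ ⬝ᵥ r = 0 := by
    intro r hr
    have := same r (by rw [hBA, vecMulVec_mulVec, hr]; simp)
    rw [hρ, vecMulVec_mulVec, op_smul_eq_smul] at this
    exact (smul_eq_zero.mp this).resolve_right hp
  obtain ⟨j, hj⟩ := Function.ne_iff.mp hγ
  have hj' : (ρ - δ) j ≠ 0 := hj
  refine ⟨ρ j / (ρ - δ) j, ?_⟩
  rw [hρ, hBA, ← vecMulVec_smul]
  congr 1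
  funext k
  have := ker (Pi.single k ((ρ - δ) j) - Pi.single j ((ρ - δ) k)) (by
    rw [dotProduct_sub, dotProduct_single, dotProduct_single]; ring)
  rw [dotProduct_sub, dotProduct_single, dotProduct_single] at this
  simp only [Pi.smul_apply, smul_eq_mul]
  field_simp
  linear_combination this

end FullRank

/-! ### Maps preserving rank-one lines -/

/-- A map of matrix spaces that preserves adjacency (the difference having rank at most one) in
both directions and carries each line of rank-one direction onto such a line. A zero direction
is allowed in `line` and `line_surj`, where the conditions are then trivial. -/
structure PreservesDyadLines {m n p q : Type*} (φ : Matrix m n F → Matrix p q F) : Prop where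
  injective : Function.Injective φ
  isDyad_iff : ∀ A B, IsDyad (φ A - φ B) ↔ IsDyad (A - B)
  line : ∀ A x y (t : F), ∃ s : F,
    φ (A + t • vecMulVec x y) - φ A = s • (φ (A + vecMulVec x y) - φ A)
  line_surj : ∀ A x y (s : F), ∃ t : F,
    φ (A + t • vecMulVec x y) - φ A = s • (φ (A + vecMulVec x y) - φ A)

section FromFullRank

variable {m n : Type*} [Fintype m] [Fintype n] [Nontrivial n]

omit [Fintype m] [Nontrivial n] in
theorem fullRankBetween_map (φ : Matrix m n F ≃ Matrix m n F)
    (h : ∀ A B, (A - B).rank = Fintype.card n ↔ (φ A - φ B).rank = Fintype.card n)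
    (A B R : Matrix m n F) : FullRankBetween (φ A) (φ B) (φ R) ↔ FullRankBetween A B R := by
  constructor
  · intro H X hX
    rw [h A X, h B X]
    exact H (φ X) ((h R X).mp hX)
  · intro H X hX
    obtain ⟨X, rfl⟩ := φ.surjective X
    rw [← h A X, ← h B X]
    exact H X ((h R X).mpr hX)

theorem isDyad_map_sub (hF : ∃ c : F, c ≠ 0 ∧ c ≠ 1) (hmn : Fintype.card n ≤ Fintype.card m)
    (φ : Matrix m n F ≃ Matrix m n F)
    (h : ∀ A B, (A - B).rank = Fintype.card n ↔ (φ A - φ B).rank = Fintype.card n)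
    {A B : Matrix m n F} (hd : IsDyad (B - A)) : IsDyad (φ B - φ A) := by
  by_cases hAB : A = B
  · exact ⟨0, 0, by rw [hAB, sub_self, zero_vecMulVec]⟩
  obtain ⟨c, hc0, hc1⟩ := hF
  have hBA : B - A ≠ 0 := sub_ne_zero.mpr (Ne.symm hAB)
  -- a third point `A + c • (B - A)` of the line
  have hR := fullRankBetween_of_line hd (R := A + c • (B - A)) (t := c) (add_sub_cancel_left _ _)
  refine (line_of_fullRankBetween hmn (φ.injective.ne hAB) (φ.injective.ne ?_)
    (φ.injective.ne ?_) ((fullRankBetween_map φ h _ _ _).mpr hR)).1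
  · intro e
    exact (smul_ne_zero hc0 hBA) (by simpa using e)
  · intro e
    refine smul_ne_zero (sub_ne_zero.mpr hc1) hBA ?_
    rw [sub_smul, one_smul, sub_eq_zero]
    exact eq_sub_of_add_eq' e

theorem fullRankBetween_iff_line (hmn : Fintype.card n ≤ Fintype.card m) {A B : Matrix m n F}
    (hAB : A ≠ B) (hd : IsDyad (B - A)) (R : Matrix m n F) :
    FullRankBetween A B R ↔ ∃ t : F, R - A = t • (B - A) := by
  refine ⟨fun h => ?_, fun ⟨t, ht⟩ => fullRankBetween_of_line hd ht⟩
  by_cases hRA : R = A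
  · exact ⟨0, by simp [hRA]⟩
  by_cases hRB : R = B
  · exact ⟨1, by simp [hRB]⟩
  exact (line_of_fullRankBetween hmn hAB hRA hRB h).2

theorem preservesDyadLines_of_rank (hF : ∃ c : F, c ≠ 0 ∧ c ≠ 1)
    (hmn : Fintype.card n ≤ Fintype.card m) (φ : Matrix m n F ≃ Matrix m n F)
    (h : ∀ A B, (A - B).rank = Fintype.card n ↔ (φ A - φ B).rank = Fintype.card n) :
    PreservesDyadLines φ := by
  have hsymm : ∀ A B, (A - B).rank = Fintype.card n ↔
      (φ.symm A - φ.symm B).rank = Fintype.card n := by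
    intro A B
    rw [h (φ.symm A), φ.apply_symm_apply, φ.apply_symm_apply]
  have key : ∀ (A : Matrix m n F) x y R, vecMulVec x y ≠ 0 →
      ((∃ s : F, φ R - φ A = s • (φ (A + vecMulVec x y) - φ A)) ↔
        ∃ t : F, R - A = t • vecMulVec x y) := by
    intro A x y R hxy
    have hd : IsDyad ((A + vecMulVec x y) - A) := ⟨x, y, add_sub_cancel_left _ _⟩
    have hne : A ≠ A + vecMulVec x y := by simpa using hxy
    rw [← fullRankBetween_iff_line hmn (φ.injective.ne hne) (isDyad_map_sub hF hmn φ h hd),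
      fullRankBetween_map φ h, fullRankBetween_iff_line hmn hne hd, add_sub_cancel_left]
  refine ⟨φ.injective, fun A B => ⟨fun hd => ?_, isDyad_map_sub hF hmn φ h⟩, ?_, ?_⟩
  · simpa using isDyad_map_sub hF hmn φ.symm hsymm hd
  · intro A x y t
    by_cases hxy : vecMulVec x y = 0
    · exact ⟨0, by simp [hxy]⟩
    exact (key A x y _ hxy).mpr ⟨t, add_sub_cancel_left _ _⟩
  · intro A x y s
    by_cases hxy : vecMulVec x y = 0
    · exact ⟨0, by simp [hxy]⟩
    obtain ⟨R, hR⟩ := φ.surjective (φ A + s • (φ (A + vecMulVec x y) - φ A))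
    obtain ⟨t, ht⟩ := (key A x y R hxy).mp ⟨s, by rw [hR, add_sub_cancel_left]⟩
    exact ⟨t, by rw [← ht, add_sub_cancel, hR, add_sub_cancel_left]⟩

end FromFullRank

namespace PreservesDyadLines

variable {m n p q : Type*} {φ : Matrix m n F → Matrix p q F}

theorem transpose_map (h : PreservesDyadLines φ) : PreservesDyadLines fun A => (φ A)ᵀ where
  injective := transpose_injective.comp h.injective
  isDyad_iff A B := by rw [← transpose_sub, isDyad_transpose, h.isDyad_iff]
  line A x y t := by
    obtain ⟨s, hs⟩ := h.line A x y t
    exact ⟨s, by rw [← transpose_sub, hs, transpose_smul, transpose_sub]⟩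
  line_surj A x y s := by
    obtain ⟨t, ht⟩ := h.line_surj A x y s
    exact ⟨t, by rw [← transpose_sub, ht, transpose_smul, transpose_sub]⟩

theorem map_transpose (h : PreservesDyadLines φ) :
    PreservesDyadLines fun A : Matrix n m F => φ Aᵀ where
  injective := h.injective.comp transpose_injective
  isDyad_iff A B := by rw [h.isDyad_iff, ← transpose_sub, isDyad_transpose]
  line A x y t := by
    simpa only [transpose_add, transpose_smul, transpose_vecMulVec] using h.line Aᵀ y x t
  line_surj A x y s := by
    simpa only [transpose_add, transpose_smul, transpose_vecMulVec] using h.line_surj Aᵀ y x s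

theorem translate (h : PreservesDyadLines φ) (B : Matrix m n F) :
    PreservesDyadLines fun A => φ (B + A) - φ B where
  injective := fun A A' e => add_left_cancel (h.injective (sub_left_injective e))
  isDyad_iff A A' := by rw [sub_sub_sub_cancel_right, h.isDyad_iff, add_sub_add_left_eq_sub]
  line A x y t := by
    simpa only [sub_sub_sub_cancel_right, ← add_assoc] using h.line (B + A) x y t
  line_surj A x y s := by
    simpa only [sub_sub_sub_cancel_right, ← add_assoc] using h.line_surj (B + A) x y s

/-- The fundamental theorem of affine geometry applied to the matrices with left factor `x`. -/
theorem map_vecMulVec_add [Nontrivial n] (h : PreservesDyadLines φ) (h0 : φ 0 = 0)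
    (hF : ∃ c : F, c ≠ 0 ∧ c ≠ 1) (x : m → F) (y y' : n → F) :
    φ (vecMulVec x (y + y')) = φ (vecMulVec x y) + φ (vecMulVec x y') := by
  by_cases hx : x = 0
  · simp [hx, h0]
  refine map_add_of_lines (f := fun y => φ (vecMulVec x y)) ?_ ?_ ?_ ?_ hF exists_ne_smul y y'
  · simp only [vecMulVec_zero_right, h0]
  · exact fun y y' e => vecMulVec_left_cancel hx (h.injective e)
  · intro a v t
    simpa only [vecMulVec_add, vecMulVec_smul] using h.line (vecMulVec x a) x v t
  · intro a v s
    simpa only [vecMulVec_add, vecMulVec_smul] using h.line_surj (vecMulVec x a) x v s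

theorem map_ne_zero (h : PreservesDyadLines φ) (h0 : φ 0 = 0) {x : m → F} {y : n → F}
    (hx : x ≠ 0) (hy : y ≠ 0) : φ (vecMulVec x y) ≠ 0 := by
  rw [← h0]
  exact h.injective.ne (vecMulVec_ne_zero' hx hy)

theorem isDyad_map_vecMulVec (h : PreservesDyadLines φ) (h0 : φ 0 = 0) (x : m → F) (y : n → F) :
    IsDyad (φ (vecMulVec x y)) := by
  have : IsDyad (φ (vecMulVec x y) - φ 0) := (h.isDyad_iff _ _).mpr ⟨x, y, sub_zero _⟩
  rwa [h0, sub_zero] at this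

/-- The images of dyads with independent left factors and independent right factors are not
adjacent. -/
theorem not_isDyad_sub (h : PreservesDyadLines φ) {x x' : m → F} {y y' : n → F}
    (hx : x ≠ 0) (hy : y ≠ 0) (hx' : ∀ c : F, x' ≠ c • x) (hy' : ∀ c : F, y' ≠ c • y) :
    ¬ IsDyad (φ (vecMulVec x y) - φ (vecMulVec x' y')) := by
  rw [h.isDyad_iff]
  intro hd
  rcases eq_smul_or_eq_smul_of_isDyad_sub hx hy hd with ⟨s, e⟩ | ⟨s, e⟩
  exacts [hx' s e, hy' s e]

end PreservesDyadLines

/-! ### The action on dyads -/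

/-- The dyads with left factor `x` are mapped to dyads with a common left factor. -/
def LeftAligned {m n p q : Type*} (φ : Matrix m n F → Matrix p q F) (x : m → F) : Prop :=
  ∃ a : p → F, a ≠ 0 ∧ ∀ y, ∃ d, φ (vecMulVec x y) = vecMulVec a d

/-- On dyads, `φ` is the tensor product of two injective maps that are semilinear with respect to
the same field automorphism. Only the values of `φ` on dyads are constrained. -/
def IsSemilinearTensor {m n p q : Type*} (φ : Matrix m n F → Matrix p q F) : Prop :=
  ∃ (σ : F ≃+* F) (f : (m → F) → p → F) (g : (n → F) → q → F),
    (∀ x x', f (x + x') = f x + f x') ∧ (∀ (c : F) x, f (c • x) = σ c • f x) ∧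
    (∀ y y', g (y + y') = g y + g y') ∧ (∀ (c : F) y, g (c • y) = σ c • g y) ∧
    (∀ x, f x = 0 → x = 0) ∧ (∀ y, g y = 0 → y = 0) ∧
    ∀ x y, φ (vecMulVec x y) = vecMulVec (f x) (g y)

namespace PreservesDyadLines

variable {m n p q : Type*} {φ : Matrix m n F → Matrix p q F}

/-- The dyads with left factor `x` are mapped to dyads that share a left or a right factor. -/
theorem leftAligned_or [Nontrivial n] (h : PreservesDyadLines φ) (h0 : φ 0 = 0)
    {x : m → F} (hx : x ≠ 0) :
    LeftAligned φ x ∨ LeftAligned (fun A => (φ A)ᵀ) x := by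
  obtain ⟨y₀, hy₀⟩ := exists_ne_smul (F := F) (0 : n → F)
  replace hy₀ : y₀ ≠ 0 := by simpa using hy₀ 0
  obtain ⟨a, b, hab⟩ := h.isDyad_map_vecMulVec h0 x y₀
  have hne := h.map_ne_zero h0 hx hy₀
  have ha : a ≠ 0 := by
    rintro rfl
    exact hne (by rw [hab, zero_vecMulVec])
  have hb : b ≠ 0 := by
    rintro rfl
    exact hne (by rw [hab, vecMulVec_zero_right])
  have adj : ∀ y y', IsDyad (φ (vecMulVec x y) - φ (vecMulVec x y')) := fun y y' =>
    (h.isDyad_iff _ _).mpr ⟨x, y - y', by rw [vecMulVec_sub]⟩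
  by_cases hA : ∀ y, ∃ d, φ (vecMulVec x y) = vecMulVec a d
  · exact Or.inl ⟨a, ha, hA⟩
  push Not at hA
  obtain ⟨y₁, hy₁⟩ := hA
  obtain ⟨c, d, hcd⟩ := h.isDyad_map_vecMulVec h0 x y₁
  have hca : ∀ s : F, c ≠ s • a := by
    rintro s rfl
    exact hy₁ (s • d) (by rw [hcd, smul_vecMulVec, vecMulVec_smul])
  have hc : c ≠ 0 := by simpa using hca 0
  obtain ⟨r, rfl⟩ : ∃ r : F, d = r • b := by
    have := adj y₀ y₁
    rw [hab, hcd] at this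
    exact (eq_smul_or_eq_smul_of_isDyad_sub ha hb this).resolve_left fun ⟨s, hs⟩ => hca s hs
  have hrb : r • b ≠ 0 := by
    intro e
    exact hy₁ 0 (by rw [hcd, e, vecMulVec_zero_right, vecMulVec_zero_right])
  refine Or.inr ⟨b, hb, fun y => ?_⟩
  obtain ⟨e, f, hef⟩ := h.isDyad_map_vecMulVec h0 x y
  obtain ⟨s, rfl⟩ | hf := (em (∃ s : F, f = s • b))
  · exact ⟨s • e, by beta_reduce; rw [hef, transpose_vecMulVec, smul_vecMulVec, vecMulVec_smul]⟩
  have h1 := adj y₀ y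
  have h2 := adj y₁ y
  rw [hab, hef] at h1
  rw [hcd, hef] at h2
  obtain ⟨s, rfl⟩ := (eq_smul_or_eq_smul_of_isDyad_sub ha hb h1).resolve_right hf
  obtain ⟨t, ht⟩ := (eq_smul_or_eq_smul_of_isDyad_sub hc hrb h2).resolve_right
    fun ⟨s, hs⟩ => hf ⟨s * r, by rw [hs, smul_smul]⟩
  by_cases hs : s = 0
  · exact ⟨0, by beta_reduce; rw [hef, hs]; simp [vecMulVec_zero_right]⟩
  -- the left factor of the image of `x yᵗ` cannot be parallel to both `a` and `c`
  · exact absurd (by rw [mul_smul, ← ht, smul_smul, inv_mul_cancel₀ hs, one_smul])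
      (ne_smul_symm ha hca (s⁻¹ * t))

/-- The two alternatives of `leftAligned_or` cannot occur at independent vectors. -/
theorem leftAligned_of_leftAligned [Nontrivial n] (h : PreservesDyadLines φ) (h0 : φ 0 = 0)
    {x x' : m → F} (hx : x ≠ 0) (hx' : x' ≠ 0)
    (hA : LeftAligned φ x) : LeftAligned φ x' := by
  by_cases hxx : ∀ c : F, x' ≠ c • x
  swap
  · push Not at hxx
    obtain ⟨c, rfl⟩ := hxx
    obtain ⟨a, ha, hA⟩ := hA
    refine ⟨a, ha, fun y => ?_⟩
    rw [smul_vecMulVec, ← vecMulVec_smul]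
    exact hA _
  refine (h.leftAligned_or h0 hx').resolve_right fun hB => ?_
  obtain ⟨a, ha, hA⟩ := hA
  obtain ⟨b, hb, hB⟩ := hB
  replace hB : ∀ y, ∃ c, φ (vecMulVec x' y) = vecMulVec c b := by
    intro y
    obtain ⟨c, hc⟩ := hB y
    beta_reduce at hc
    exact ⟨c, by rw [← transpose_transpose (φ _), hc, transpose_vecMulVec]⟩
  obtain ⟨y, hy⟩ := exists_ne_smul (F := F) (0 : n → F)
  replace hy : y ≠ 0 := by simpa using hy 0
  obtain ⟨y', hy'⟩ := exists_ne_smul y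
  have hy0' : y' ≠ 0 := by simpa using hy' 0
  obtain ⟨d, hd⟩ := hA y
  obtain ⟨c, hc⟩ := hB y
  obtain ⟨d', hd'⟩ := hA y'
  obtain ⟨c', hc'⟩ := hB y'
  have hd0 : d ≠ 0 := by
    rintro rfl
    exact h.map_ne_zero h0 hx hy (by rw [hd, vecMulVec_zero_right])
  have adj : IsDyad (φ (vecMulVec x y) - φ (vecMulVec x' y)) :=
    (h.isDyad_iff _ _).mpr ⟨x - x', y, by rw [sub_vecMulVec]⟩
  rw [hd, hc] at adj
  rcases eq_smul_or_eq_smul_of_isDyad_sub ha hd0 adj with ⟨s, rfl⟩ | ⟨s, rfl⟩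
  · refine h.not_isDyad_sub hx hy0' hxx (ne_smul_symm hy hy') ?_
    exact ⟨a, d' - s • b, by rw [hd', hc, vecMulVec_sub, smul_vecMulVec, vecMulVec_smul]⟩
  · refine h.not_isDyad_sub hx hy hxx hy' ?_
    obtain ⟨r, hr⟩ : ∃ r : F, d = r • (s • d) := by
      have hs : s ≠ 0 := by
        rintro rfl
        simp at hb
      exact ⟨s⁻¹, by rw [smul_smul, inv_mul_cancel₀ hs, one_smul]⟩
    refine ⟨r • a - c', s • d, ?_⟩
    rw [hd, hc', sub_vecMulVec, smul_vecMulVec, ← vecMulVec_smul, ← hr]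

/-- If `φ` keeps common left factors, it keeps common right factors. -/
theorem leftAligned_transpose [Nontrivial m] [Nontrivial n] (h : PreservesDyadLines φ)
    (h0 : φ 0 = 0) (hA : ∀ x, x ≠ 0 → LeftAligned φ x)
    {y : n → F} (hy : y ≠ 0) : LeftAligned (fun A : Matrix n m F => (φ Aᵀ)ᵀ) y := by
  refine (h.map_transpose.leftAligned_or (by simpa using h0) hy).resolve_left ?_
  rintro ⟨a, ha, hB⟩
  simp only [transpose_vecMulVec] at hB
  obtain ⟨x, hx⟩ := exists_ne_smul (F := F) (0 : m → F)
  replace hx : x ≠ 0 := by simpa using hx 0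
  obtain ⟨x', hx'⟩ := exists_ne_smul x
  have hx0' : x' ≠ 0 := by simpa using hx' 0
  obtain ⟨y', hy'⟩ := exists_ne_smul y
  obtain ⟨a', ha', hA'⟩ := hA x' hx0'
  obtain ⟨d, hd⟩ := hA' y
  obtain ⟨d', hd'⟩ := hA' y'
  obtain ⟨e, he⟩ := hB x
  obtain ⟨e', he'⟩ := hB x'
  have hd0 : d ≠ 0 := by
    rintro rfl
    exact h.map_ne_zero h0 hx0' hy (by rw [hd, vecMulVec_zero_right])
  obtain ⟨s, rfl⟩ := left_eq_smul_of_vecMulVec_eq hd0 (hd.symm.trans he')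
  refine h.not_isDyad_sub hx hy hx' hy' ⟨a, e - s • d', ?_⟩
  rw [he, hd', vecMulVec_sub, smul_vecMulVec, vecMulVec_smul]

/-- If `φ` keeps common left factors, then it is a tensor product on dyads. The maps `f` and `g`
are read off from the dyads with a fixed right or left factor; alignment gives
`φ (x yᵗ) = s • f x (g y)ᵗ`, and additivity of `φ` in `y` forces `s = 1`. -/
theorem isSemilinearTensor_of_leftAligned [Nontrivial m] [Nontrivial n]
    (h : PreservesDyadLines φ) (h0 : φ 0 = 0) (hF : ∃ c : F, c ≠ 0 ∧ c ≠ 1)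
    (hA : ∀ x, x ≠ 0 → LeftAligned φ x) : IsSemilinearTensor φ := by
  have add_right := h.map_vecMulVec_add h0 hF
  have add_left : ∀ x x' y,
      φ (vecMulVec (x + x') y) = φ (vecMulVec x y) + φ (vecMulVec x' y) := by
    intro x x' y
    simpa only [transpose_vecMulVec] using
      h.map_transpose.map_vecMulVec_add (by simpa using h0) hF y x x'
  have hB : ∀ y, y ≠ 0 → ∃ b : q → F, b ≠ 0 ∧ ∀ x, ∃ c, φ (vecMulVec x y) = vecMulVec c b := by
    intro y hy
    obtain ⟨b, hb, hB⟩ := h.leftAligned_transpose h0 hA hy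
    refine ⟨b, hb, fun x => ?_⟩
    obtain ⟨c, hc⟩ := hB x
    simp only [transpose_vecMulVec] at hc
    exact ⟨c, by rw [← transpose_transpose (φ _), hc, transpose_vecMulVec]⟩
  obtain ⟨u, hu⟩ := exists_ne_smul (F := F) (0 : m → F)
  replace hu : u ≠ 0 := by simpa using hu 0
  obtain ⟨w, hw⟩ := exists_ne_smul (F := F) (0 : n → F)
  replace hw : w ≠ 0 := by simpa using hw 0
  obtain ⟨a, ha, hau⟩ := hA u hu
  choose g hg using hau
  have hg0 : ∀ y, g y = 0 → y = 0 := by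
    intro y hy
    by_contra hy0
    exact h.map_ne_zero h0 hu hy0 (by rw [hg, hy, vecMulVec_zero_right])
  have hgw : g w ≠ 0 := fun e => hw (hg0 w e)
  have hfw : ∀ x, ∃ c, φ (vecMulVec x w) = vecMulVec c (g w) := by
    obtain ⟨b, hb, hbw⟩ := hB w hw
    intro x
    obtain ⟨c, hc⟩ := hbw x
    obtain ⟨c', hc'⟩ := hbw u
    obtain ⟨s, hs⟩ : ∃ s : F, b = s • g w := by
      refine right_eq_smul_of_vecMulVec_eq (a := c') ?_ (hc'.symm.trans (hg w))
      rintro rfl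
      exact h.map_ne_zero h0 hu hw (by rw [hc', zero_vecMulVec])
    exact ⟨s • c, by rw [hc, hs, smul_vecMulVec, vecMulVec_smul]⟩
  choose f hf using hfw
  have hf0 : ∀ x, f x = 0 → x = 0 := by
    intro x hx
    by_contra hx0
    exact h.map_ne_zero h0 hx0 hw (by rw [hf, hx, zero_vecMulVec])
  have f_zero : f 0 = 0 :=
    vecMulVec_right_cancel hgw (by rw [← hf, zero_vecMulVec, h0, zero_vecMulVec])
  have g_add : ∀ y y', g (y + y') = g y + g y' := fun y y' =>
    vecMulVec_left_cancel ha (by rw [← hg, add_right, hg, hg, vecMulVec_add])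
  have f_add : ∀ x x', f (x + x') = f x + f x' := fun x x' =>
    vecMulVec_right_cancel hgw (by rw [← hf, add_left, hf, hf, add_vecMulVec])
  have g_zero : g 0 = 0 := by simpa using g_add 0 0
  have scaled : ∀ x y, ∃ s : F, φ (vecMulVec x y) = s • vecMulVec (f x) (g y) := by
    intro x y
    by_cases hx : x = 0
    · exact ⟨0, by simp [hx, h0]⟩
    by_cases hy : y = 0
    · exact ⟨0, by simp [hy, h0, vecMulVec_zero_right]⟩
    obtain ⟨a', ha', hx'⟩ := hA x hx
    obtain ⟨b', hb', hy'⟩ := hB y hy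
    obtain ⟨d, hd⟩ := hx' w
    obtain ⟨e, he⟩ := hx' y
    obtain ⟨c', hc'⟩ := hy' u
    obtain ⟨c, hc⟩ := hy' x
    have hfx : f x ≠ 0 := fun e => hx (hf0 x e)
    have hgy : g y ≠ 0 := fun e => hy (hg0 y e)
    have hd0 : d ≠ 0 := by
      rintro rfl
      exact h.map_ne_zero h0 hx hw (by rw [hd, vecMulVec_zero_right])
    have he0 : e ≠ 0 := by
      rintro rfl
      exact h.map_ne_zero h0 hx hy (by rw [he, vecMulVec_zero_right])
    have hc0' : c' ≠ 0 := by
      rintro rfl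
      exact h.map_ne_zero h0 hu hy (by rw [hc', zero_vecMulVec])
    obtain ⟨s, hs⟩ := left_eq_smul_of_vecMulVec_eq hd0 (hd.symm.trans (hf x))
    obtain ⟨r, hr⟩ := right_eq_smul_of_vecMulVec_eq hc0' (hc'.symm.trans (hg y))
    obtain ⟨t, ht⟩ := right_eq_smul_of_vecMulVec_eq ha' (he.symm.trans hc)
    refine ⟨s * (t * r), ?_⟩
    rw [he, hs, ht, hr, smul_vecMulVec, vecMulVec_smul, vecMulVec_smul, smul_smul, smul_smul,
      mul_assoc]
  have generic : ∀ x y, (∀ c : F, y ≠ c • w) →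
      φ (vecMulVec x y) = vecMulVec (f x) (g y) := by
    intro x y hy
    by_cases hx : x = 0
    · simp [hx, h0, f_zero]
    have hfx : f x ≠ 0 := fun e => hx (hf0 x e)
    obtain ⟨s, hs⟩ := scaled x y
    obtain ⟨t, ht⟩ := scaled x (w + y)
    rw [add_right, hf, hs, g_add, ← vecMulVec_smul, ← vecMulVec_smul, ← vecMulVec_add] at ht
    have e := vecMulVec_left_cancel hfx ht
    -- `g y` is not a multiple of `g w`, since the images of `u wᵗ` and `x' yᵗ` are not adjacent
    have hgy : ∀ c : F, g y ≠ c • g w := by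
      intro c hc
      obtain ⟨x', hx'⟩ := exists_ne_smul u
      obtain ⟨r, hr⟩ := scaled x' y
      refine h.not_isDyad_sub hu hw hx' hy ⟨a - (r * c) • f x', g w, ?_⟩
      rw [hg, hr, hc, sub_vecMulVec, smul_vecMulVec, vecMulVec_smul, smul_smul]
    have e' : (s - t) • g y = (t - 1) • g w := by
      rw [smul_add] at e
      rw [sub_smul, sub_smul, one_smul, sub_eq_sub_iff_add_eq_add, add_comm, e]
    have hst : s = t := by
      by_contra hst
      refine hgy ((s - t)⁻¹ * (t - 1)) ?_
      rw [mul_smul, ← e', smul_smul, inv_mul_cancel₀ (sub_ne_zero.mpr hst), one_smul]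
    rw [hst, sub_self, zero_smul, eq_comm, smul_eq_zero] at e'
    rw [hs, hst, sub_eq_zero.mp (e'.resolve_right hgw), one_smul]
  have tensor : ∀ x y, φ (vecMulVec x y) = vecMulVec (f x) (g y) := by
    intro x y
    by_cases hy : ∀ c : F, y ≠ c • w
    · exact generic x y hy
    push Not at hy
    obtain ⟨c, rfl⟩ := hy
    obtain ⟨z, hz⟩ := exists_ne_smul w
    have e := add_right x (c • w) z
    rw [generic x z hz, generic x (c • w + z), g_add, vecMulVec_add] at e
    · exact (add_right_cancel e).symm
    · intro d e
      exact hz (d - c) (by rw [sub_smul, ← e]; abel)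
  have scalar : ∀ (c : F) x, ∃ s : F, f (c • x) = s • f x := by
    intro c x
    obtain ⟨s, hs⟩ := h.line 0 x w c
    rw [zero_add, zero_add, h0, sub_zero, sub_zero, ← smul_vecMulVec, hf, hf,
      ← smul_vecMulVec] at hs
    exact ⟨s, vecMulVec_right_cancel hgw hs⟩
  have transfer : ∀ (c s : F) x, x ≠ 0 → f (c • x) = s • f x → ∀ y, g (c • y) = s • g y := by
    intro c s x hx hs y
    refine vecMulVec_left_cancel (a := f x) (fun e => hx (hf0 x e)) ?_
    rw [← tensor, vecMulVec_smul, ← smul_vecMulVec, tensor, hs, smul_vecMulVec, vecMulVec_smul]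
  choose τ hτ using fun c => scalar c u
  have hτg : ∀ c y, g (c • y) = τ c • g y := fun c => transfer c (τ c) u hu (hτ c)
  have hτf : ∀ c x, f (c • x) = τ c • f x := by
    intro c x
    by_cases hx : x = 0
    · simp [hx, f_zero]
    obtain ⟨s, hs⟩ := scalar c x
    rw [hs]
    have := transfer c s x hx hs w
    rw [hτg] at this
    rw [smul_left_injective F hgw this]
  have hτ_inj := smul_left_injective F hgw
  let σ : F →+* F :=
    { toFun := τ
      map_one' := hτ_inj (by simp only [← hτg, one_smul])
      map_mul' := fun c d => hτ_inj (by simp only [← hτg, mul_smul])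
      map_zero' := hτ_inj (by simp only [← hτg, zero_smul, g_zero])
      map_add' := fun c d => hτ_inj (by simp only [← hτg, add_smul, g_add]) }
  have hσ : Function.Bijective σ := by
    refine ⟨σ.injective, fun s => ?_⟩
    obtain ⟨t, ht⟩ := h.line_surj 0 u w s
    rw [zero_add, zero_add, h0, sub_zero, sub_zero, ← vecMulVec_smul, hg, hg,
      ← vecMulVec_smul, hτg] at ht
    exact ⟨t, hτ_inj (vecMulVec_left_cancel ha ht)⟩
  exact ⟨RingEquiv.ofBijective σ hσ, f, g, f_add, hτf, g_add, hτg, hf0, hg0, tensor⟩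

theorem isSemilinearTensor_or [Nontrivial m] [Nontrivial n]
    (h : PreservesDyadLines φ) (h0 : φ 0 = 0) (hF : ∃ c : F, c ≠ 0 ∧ c ≠ 1) :
    IsSemilinearTensor φ ∨ IsSemilinearTensor fun A => (φ A)ᵀ := by
  obtain ⟨u, hu⟩ := exists_ne_smul (F := F) (0 : m → F)
  replace hu : u ≠ 0 := by simpa using hu 0
  have h0' : (φ 0)ᵀ = 0 := by rw [h0, transpose_zero]
  rcases h.leftAligned_or h0 hu with hA | hA
  · exact Or.inl (h.isSemilinearTensor_of_leftAligned h0 hF fun x hx =>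
      h.leftAligned_of_leftAligned h0 hu hx hA)
  · exact Or.inr (h.transpose_map.isSemilinearTensor_of_leftAligned h0' hF fun x hx =>
      h.transpose_map.leftAligned_of_leftAligned h0' hu hx hA)

/-! ### Additivity -/

/-- If `φ` and its translate `X ↦ φ (u wᵗ + X) - φ (u wᵗ)` are both tensor products up to
transposition, they agree on dyads, because they agree on those with left factor `u` and on those
with right factor `w`. -/
theorem map_vecMulVec_add_vecMulVec [Nontrivial m] [Nontrivial n] (h : PreservesDyadLines φ)
    (h0 : φ 0 = 0) (hF : ∃ c : F, c ≠ 0 ∧ c ≠ 1) (hT : IsSemilinearTensor φ)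
    (u x : m → F) (w y : n → F) :
    φ (vecMulVec u w + vecMulVec x y) = φ (vecMulVec u w) + φ (vecMulVec x y) := by
  by_cases hu : u = 0
  · simp [hu, h0]
  by_cases hw : w = 0
  · simp [hw, h0, vecMulVec_zero_right]
  obtain ⟨σ, f, g, f_add, f_smul, g_add, g_smul, hf0, hg0, hfg⟩ := hT
  have hfu : f u ≠ 0 := fun e => hu (hf0 u e)
  have hgw : g w ≠ 0 := fun e => hw (hg0 w e)
  have left : ∀ y, φ (vecMulVec u w + vecMulVec u y) - φ (vecMulVec u w)
      = vecMulVec (f u) (g y) := by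
    intro y
    rw [← vecMulVec_add, hfg, hfg, g_add, vecMulVec_add, add_sub_cancel_left]
  have right : ∀ x, φ (vecMulVec u w + vecMulVec x w) - φ (vecMulVec u w)
      = vecMulVec (f x) (g w) := by
    intro x
    rw [← add_vecMulVec, hfg, hfg, f_add, add_vecMulVec, add_sub_cancel_left]
  rw [← sub_eq_iff_eq_add', hfg x y]
  rcases (h.translate (vecMulVec u w)).isSemilinearTensor_or (by simp) hF with hT' | hT'
  · obtain ⟨σ', f', g', -, -, -, -, hf0', hg0', hfg'⟩ := hT'
    simp only at hfg'
    rw [hfg']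
    have hgw' : g' w ≠ 0 := fun e => hw (hg0' w e)
    have hfu' : f' u ≠ 0 := fun e => hu (hf0' u e)
    obtain ⟨s, hs⟩ := left_eq_smul_of_vecMulVec_eq hgw' ((hfg' u w).symm.trans (left w))
    have hg' : ∀ y, s • g' y = g y := by
      intro y
      refine vecMulVec_left_cancel hfu ?_
      rw [← left, hfg', hs, smul_vecMulVec, vecMulVec_smul]
    have hs0 : s ≠ 0 := by
      rintro rfl
      exact hgw (by rw [← hg', zero_smul])
    have hf' : ∀ x, f' x = s • f x := by
      intro x
      refine vecMulVec_right_cancel hgw' ?_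
      rw [← hfg', right, ← hg', smul_vecMulVec, vecMulVec_smul]
    rw [hf', ← hg', smul_vecMulVec, vecMulVec_smul]
  · -- in the transposed form, `g` would have image in the line of `f' u`
    exfalso
    obtain ⟨σ', f', g', -, -, -, -, hf0', hg0', hfg'⟩ := hT'
    have hg' : ∀ y, ∃ s : F, g y = s • f' u := by
      intro y
      refine right_eq_smul_of_vecMulVec_eq (c := g' y) hfu ?_
      rw [← left, ← transpose_vecMulVec (f' u), ← hfg', transpose_transpose]
    obtain ⟨z, hz⟩ := exists_ne_smul w
    obtain ⟨s, hs⟩ := hg' w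
    obtain ⟨t, ht⟩ := hg' z
    have hs0 : s ≠ 0 := by
      rintro rfl
      exact hgw (by rw [hs, zero_smul])
    refine hz (σ.symm (t * s⁻¹)) (sub_eq_zero.mp (hg0 _ ?_))
    have hneg : ∀ v, g (-v) = -g v := by
      intro v
      rw [← neg_one_smul F, g_smul, map_neg, map_one, neg_one_smul]
    rw [sub_eq_add_neg, g_add, hneg, g_smul, σ.apply_symm_apply, hs, ht, smul_smul,
      inv_mul_cancel_right₀ hs0, add_neg_cancel]

end PreservesDyadLines

theorem Matrix.induction_on_vecMulVec {m n : Type*} [Finite m] [Finite n]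
    {P : Matrix m n F → Prop} (M : Matrix m n F) (zero : P 0)
    (add : ∀ A B, P A → P B → P (A + B)) (dyad : ∀ x y, P (vecMulVec x y)) : P M := by
  classical
  refine Matrix.induction_on' M zero add fun i j c => ?_
  have : single i j c = vecMulVec (c • Pi.single i (1 : F)) (Pi.single j (1 : F)) := by
    rw [smul_vecMulVec, ← single_eq_single_vecMulVec_single, smul_single, smul_eq_mul, mul_one]
  rw [this]
  exact dyad _ _

namespace PreservesDyadLines

variable {m n p q : Type*} {φ : Matrix m n F → Matrix p q F}

/-- Translates of `φ` at adjacent points agree on dyads, hence so do all translates. -/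
theorem map_add [Finite m] [Finite n] [Nontrivial m] [Nontrivial n] (h : PreservesDyadLines φ)
    (h0 : φ 0 = 0) (hF : ∃ c : F, c ≠ 0 ∧ c ≠ 1) (hT : IsSemilinearTensor φ)
    (A B : Matrix m n F) : φ (A + B) = φ A + φ B := by
  have dyads : ∀ (A : Matrix m n F) x y,
      φ (A + vecMulVec x y) = φ A + φ (vecMulVec x y) := by
    -- generalize over the point `C`, whose translate is assumed to agree with `φ` on dyads
    suffices H : ∀ A C : Matrix m n F, (∀ x y, φ (C + vecMulVec x y) = φ C + φ (vecMulVec x y)) →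
        ∀ x y, φ (C + A + vecMulVec x y) = φ (C + A) + φ (vecMulVec x y) by
      intro A x y
      simpa using H A 0 (by simp [h0]) x y
    intro A
    induction A using Matrix.induction_on_vecMulVec with
    | zero => simp
    | add A B hA hB =>
      intro C hC
      rw [← add_assoc]
      exact hB (C + A) (hA C hC)
    | dyad u w =>
      intro C hC x y
      obtain ⟨σ, f, g, hfg⟩ := hT
      have hT' : IsSemilinearTensor fun X => φ (C + X) - φ C := by
        simp only [IsSemilinearTensor, hC, add_sub_cancel_left]
        exact ⟨σ, f, g, hfg⟩
      have := (h.translate C).map_vecMulVec_add_vecMulVec (by simp) hF hT' u x w y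
      simp only [hC x y, add_sub_cancel_left] at this
      rw [sub_eq_iff_eq_add, ← add_assoc] at this
      rw [this]
      abel
  induction B using Matrix.induction_on_vecMulVec generalizing A with
  | zero => simp [h0]
  | add B B' hB hB' => rw [← add_assoc, hB', hB, hB', add_assoc]
  | dyad x y => exact dyads A x y

end PreservesDyadLines

/-! ### Coordinates -/

theorem exists_matrix_of_semilinear {m p : Type*} [Fintype m] (σ : F ≃+* F)
    (f : (m → F) → p → F) (f_add : ∀ x x', f (x + x') = f x + f x')
    (f_smul : ∀ (c : F) x, f (c • x) = σ c • f x) (hf0 : ∀ x, f x = 0 → x = 0) :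
    ∃ T : Matrix p m F, (∀ x, f x = T *ᵥ (σ ∘ x)) ∧ Function.Injective T.mulVec := by
  classical
  have hf : ∀ x, f x = (Matrix.of fun i j => f (Pi.single j 1) i) *ᵥ (σ ∘ x) := by
    intro x
    let fh : (m → F) →+ (p → F) := AddMonoidHom.mk' f f_add
    have e : f x = ∑ j, f (x j • Pi.single j 1) := by
      conv_lhs => rw [pi_eq_sum_univ' x]
      exact map_sum fh _ _
    rw [e]
    funext i
    simp [f_smul, mulVec, dotProduct, mul_comm]
  refine ⟨_, hf, fun z z' hz => ?_⟩
  have h1 : ∀ z : m → F, σ ∘ (σ.symm ∘ z) = z := fun z => by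
    funext i
    simp
  have h2 := hf0 (σ.symm ∘ (z - z')) (by rw [hf, h1, mulVec_sub]; exact sub_eq_zero.mpr hz)
  have h3 := h1 (z - z')
  rw [h2] at h3
  refine sub_eq_zero.mp (h3.symm.trans ?_)
  funext i
  simp

theorem eq_mul_map_mul_of_tensor {m n p q : Type*} [Fintype m] [Fintype n]
    {φ : Matrix m n F → Matrix p q F} (hadd : ∀ A B, φ (A + B) = φ A + φ B) (σ : F ≃+* F)
    {T : Matrix p m F} {S : Matrix q n F}
    (h : ∀ x y, φ (vecMulVec x y) = vecMulVec (T *ᵥ (σ ∘ x)) (S *ᵥ (σ ∘ y)))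
    (A : Matrix m n F) : φ A = T * A.map σ * Sᵀ := by
  induction A using Matrix.induction_on_vecMulVec with
  | zero =>
    have h0 : φ 0 = 0 := by simpa using hadd 0 0
    simp [h0]
  | add A B hA hB => rw [hadd, hA, hB, Matrix.map_add _ (map_add σ), Matrix.mul_add, Matrix.add_mul]
  | dyad x y =>
    have : (vecMulVec x y).map σ = vecMulVec (σ ∘ x) (σ ∘ y) := by
      ext i j
      simp [vecMulVec_apply]
    rw [h, this, mul_vecMulVec, vecMulVec_mul, vecMul_transpose]

end

/-! ### Preservers of full-rank differences -/

theorem theorem1 {F : Type*} [Field F] (hF : 3 ≤ ENat.card F)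
    (m n : ℕ) (hn : 2 ≤ n) (hmn : n ≤ m)
    (φ : Matrix (Fin m) (Fin n) F → Matrix (Fin m) (Fin n) F)
    (hφ : Function.Bijective φ)
    (hrank : ∀ A B : Matrix (Fin m) (Fin n) F,
      (A - B).rank = n ↔ (φ A - φ B).rank = n) :
    ∃ (T : Matrix (Fin m) (Fin m) F) (S : Matrix (Fin n) (Fin n) F)
      (R : Matrix (Fin m) (Fin n) F) (σ : F ≃+* F),
      IsUnit T ∧ IsUnit S ∧
        ((∀ A, φ A = T * A.map σ * S + R) ∨
          ∃ h : m = n, ∀ A, φ A =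
            T * ((A.map σ).transpose.submatrix (Fin.cast h) (Fin.cast h.symm)) * S + R) := by
  have hc : ∃ c : F, c ≠ 0 ∧ c ≠ 1 := by
    by_contra! hcon
    have hsub : (Set.univ : Set F) ⊆ {0, 1} := fun c _ => by
      by_cases h : c = 0
      · exact Or.inl h
      · exact Or.inr (hcon c h)
    have h2 : ENat.card F ≤ 2 := by
      rw [← Set.encard_univ]
      exact (Set.encard_le_encard hsub).trans ((Set.encard_insert_le _ _).trans (by rw [Set.encard_singleton]; rfl))
    exact absurd (hF.trans h2) (by decide)
  have : Nontrivial (Fin n) := Fin.nontrivial_iff_two_le.mpr hn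
  have : Nontrivial (Fin m) := Fin.nontrivial_iff_two_le.mpr (hn.trans hmn)
  have hφL : PreservesDyadLines φ :=
    preservesDyadLines_of_rank hc (by simpa using hmn) (Equiv.ofBijective φ hφ)
      (by simpa using hrank)
  let ψ : Matrix (Fin m) (Fin n) F → Matrix (Fin m) (Fin n) F := fun A => φ (0 + A) - φ 0
  have hψ : PreservesDyadLines ψ := hφL.translate 0
  have h0 : ψ 0 = 0 := by simp [ψ]
  have hφψ : ∀ A, φ A = ψ A + φ 0 := fun A => by simp [ψ]
  rcases hψ.isSemilinearTensor_or h0 hc with hT | hT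
  · have hadd := hψ.map_add h0 hc hT
    obtain ⟨σ, f, g, f_add, f_smul, g_add, g_smul, hf0, hg0, hfg⟩ := hT
    obtain ⟨T, hT, hTinj⟩ := exists_matrix_of_semilinear σ f f_add f_smul hf0
    obtain ⟨S, hS, hSinj⟩ := exists_matrix_of_semilinear σ g g_add g_smul hg0
    refine ⟨T, Sᵀ, φ 0, σ, mulVec_injective_iff_isUnit.mp hTinj,
      (isUnit_transpose S).mpr (mulVec_injective_iff_isUnit.mp hSinj), Or.inl fun A => ?_⟩
    rw [hφψ, eq_mul_map_mul_of_tensor hadd σ (fun x y => by rw [hfg, hT, hS])]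
  · have hadd := hψ.transpose_map.map_add (by simpa using h0) hc hT
    obtain ⟨σ, f, g, f_add, f_smul, g_add, g_smul, hf0, hg0, hfg⟩ := hT
    obtain ⟨S, hS, hSinj⟩ := exists_matrix_of_semilinear σ f f_add f_smul hf0
    obtain ⟨T, hT, hTinj⟩ := exists_matrix_of_semilinear σ g g_add g_smul hg0
    -- `S` maps `F ^ m` injectively into `F ^ n`
    have hle : m ≤ n := by
      have := LinearMap.finrank_le_finrank_of_injective (f := S.mulVecLin) hSinj
      simpa using this
    obtain rfl : m = n := le_antisymm hle hmn
    refine ⟨T, Sᵀ, φ 0, σ, mulVec_injective_iff_isUnit.mp hTinj,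
      (isUnit_transpose S).mpr (mulVec_injective_iff_isUnit.mp hSinj), Or.inr ⟨rfl, fun A => ?_⟩⟩
    have := eq_mul_map_mul_of_tensor (φ := fun A => (ψ A)ᵀ) hadd σ
      (fun x y => (hfg x y).trans (by rw [hS, hT])) A
    rw [hφψ, ← transpose_transpose (ψ A), this, transpose_mul, transpose_mul, transpose_transpose,
      ← Matrix.mul_assoc]
    rfl
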